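/- Let $l,n,d$ be natural numbers with $d\ge 1$ and let $\vec d=(d_1,\dots,d_n)$ be positive integers. Write $[k]=\{1,\dots,k\}$. In the scenario $(l,n,\vec d)$ Alice gets an input $x\in[l]$ and sends a $d$-dimensional classical or quantum message to Bob, who gets an input $y\in[n]$ and outputs $b_y\in[d_y]$. A POVM on $\mathbb C^d$ is a family of positive semidefinite $d\times d$ matrices summing to $\mathbb 1$. A family of POVMs $\{M_{b|i}\}_{b}$, indexed by $i$ in a (possibly infinite) set and each with finitely many outcomes, is compatible if there are a single discrete POVM $\{G_\kappa\}_\kappa$ and numbers $P_i(b|\kappa)\ge 0$ with $\sum_b P_i(b|\kappa)=1$ such that $M_{b|i}=\sum_\kappa P_i(b|\kappa)\,G_\kappa$ for all $i,b$. Consider the following sets of statistics $\{p(b_y|x,y)\}_{x,y,b_y}$. - $\mathcal C_d$: all $p(b_y|x,y)=\sum_{m=1}^d\int \pi(d\lambda)\,p_a(m|x,\lambda)\,p_b(b_y|y,m,\lambda)$, where $\pi$ is a probability measure on an arbitrary measurable space (shared randomness), and $p_a(\cdot|x,\lambda)$ and $p_b(\cdot|y,m,\lambda)$ are probability distributions on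 $[d]$ and $[d_y]$ depending measurably on $\lambda$. - $\mathcal Q^C_d$: all $p(b_y|x,y)=\int \pi(d\lambda)\,\mathrm{Tr}(\rho_{x,\lambda}M_{b_y|y,\lambda})$, where $\pi$ is a probability measure on an arbitrary measurable space, $\rho_{x,\lambda}$ are density matrices on $\mathbb C^d$ and $\{M_{b_y|y,\lambda}\}_{b_y}$ are POVMs on $\mathbb C^d$, all depending measurably on $\lambda$, such that the whole family of POVMs indexed by $(y,\lambda)$ is compatible. - $\overline{\mathcal Q}^C_d$: all $p(b_y|x,y)=\mathrm{Tr}(\rho_xM_{b_y|y})$, where $\rho_x$ are density matrices on $\mathbb C^d$ and $\{M_{b_y|y}\}_{b_y}$, $y\in[n]$, is a compatible family of POVMs on $\mathbb C^d$. Then every real linear functional $S$ of the statistics, $S(p)=\sum_{x,y,b_y}c_{x,y,b_y}\,p(b_y|x,y)$ with $c_{x,y,b_y}\in\mathbb R$, attains a maximum over each of $\mathcal C_d$, $\mathcal Q^C_d$ and $\overline{\mathcal Q}^C_d$, and the three maxima are equal. -/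

import Mathlib

open scoped ComplexOrder

noncomputable section

namespace PrepMeas

/-- Statistics `p x y b = p(b_y | x, y)` of the scenario `(l, n, D)`: Alice's input is `x ∈ [l]`,
Bob's input is `y ∈ [n]`, and Bob's outcome on input `y` is `b ∈ [D y]`. -/
abbrev Stat (l n : ℕ) (D : Fin n → ℕ) : Type :=
  (x : Fin l) → (y : Fin n) → Fin (D y) → ℝ

/-- A probability distribution on a finite set. -/
def IsDistr {α : Type} [Fintype α] (q : α → ℝ) : Prop :=
  (∀ a, 0 ≤ q a) ∧ ∑ a, q a = 1

/-- A quantum state (density matrix) on `ℂ^d`. -/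
def IsState {d : ℕ} (ρ : Matrix (Fin d) (Fin d) ℂ) : Prop :=
  ρ.PosSemidef ∧ ρ.trace = 1

/-- A (discrete) POVM on `ℂ^d` with outcome set `κ`; for finite `κ` the sum is the finite sum. -/
def IsPOVM {d : ℕ} {κ : Type} (G : κ → Matrix (Fin d) (Fin d) ℂ) : Prop :=
  (∀ k, (G k).PosSemidef) ∧ HasSum G 1

/-- The Born rule `Tr (ρ E)`; for positive semidefinite `ρ` and `E` this trace is a
nonnegative real number, so that taking the real part loses nothing. -/
def born {d : ℕ} (ρ E : Matrix (Fin d) (Fin d) ℂ) : ℝ :=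
  ((ρ * E).trace).re

/-- Compatibility of a family `(M i)` of measurements, `M i` having outcomes in `[K i]`: there
are one parent POVM `G` and post-processings `P i (b | k)` such that
`M i b = ∑ k, P i (b | k) • G k` for all `i` and `b`. -/
def Compatible {d : ℕ} {ι : Type} {K : ι → ℕ}
    (M : (i : ι) → Fin (K i) → Matrix (Fin d) (Fin d) ℂ) : Prop :=
  ∃ (κ : Type) (G : κ → Matrix (Fin d) (Fin d) ℂ) (P : (i : ι) → Fin (K i) → κ → ℝ),
    IsPOVM G ∧
    (∀ i k, IsDistr (fun b => P i b k)) ∧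
    ∀ i b, HasSum (fun k => (P i b k : ℂ) • G k) (M i b)

/-- `C_d`: statistics of `d`-dimensional classical communication with unlimited pre-shared
randomness `ω ∈ Ω` of law `μ`, encodings `pa x ω m = p_a(m | x, ω)` and decodings
`pb y m ω b = p_b(b | y, m, ω)`. -/
def classicalSet (d l n : ℕ) (D : Fin n → ℕ) : Set (Stat l n D) :=
  {p | ∃ (Ω : Type) (_ : MeasurableSpace Ω) (μ : MeasureTheory.Measure Ω)
      (pa : Fin l → Ω → Fin d → ℝ) (pb : (y : Fin n) → Fin d → Ω → Fin (D y) → ℝ),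
    MeasureTheory.IsProbabilityMeasure μ ∧
    (∀ x ω, IsDistr (pa x ω)) ∧
    (∀ y m ω, IsDistr (pb y m ω)) ∧
    (∀ x m, Measurable (fun ω => pa x ω m)) ∧
    (∀ y m b, Measurable (fun ω => pb y m ω b)) ∧
    ∀ x y b, p x y b = ∑ m, ∫ ω, pa x ω m * pb y m ω b ∂μ}

/-- `Q^C_d`: statistics of `d`-dimensional quantum communication with unlimited pre-shared
randomness `ω ∈ Ω` of law `μ`, where the whole family of Bob's measurements, indexed by
`(y, ω)`, is compatible, so that the parent POVM does not depend on `y` or on `ω`. -/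
def quantumCompatSet (d l n : ℕ) (D : Fin n → ℕ) : Set (Stat l n D) :=
  {p | ∃ (Ω : Type) (_ : MeasurableSpace Ω) (μ : MeasureTheory.Measure Ω)
      (ρ : Fin l → Ω → Matrix (Fin d) (Fin d) ℂ)
      (M : (y : Fin n) → Ω → Fin (D y) → Matrix (Fin d) (Fin d) ℂ),
    MeasureTheory.IsProbabilityMeasure μ ∧
    (∀ x ω, IsState (ρ x ω)) ∧
    (∀ y ω, IsPOVM (M y ω)) ∧
    (∀ x i j, Measurable (fun ω => ρ x ω i j)) ∧
    (∀ y b i j, Measurable (fun ω => M y ω b i j)) ∧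
    Compatible (ι := Fin n × Ω) (K := fun i => D i.1) (fun i b => M i.1 i.2 b) ∧
    ∀ x y b, p x y b = ∫ ω, born (ρ x ω) (M y ω b) ∂μ}

/-- `Q̄^C_d`: statistics of `d`-dimensional quantum communication with compatible measurements
and without shared randomness. -/
def quantumCompatSetNoSR (d l n : ℕ) (D : Fin n → ℕ) : Set (Stat l n D) :=
  {p | ∃ (ρ : Fin l → Matrix (Fin d) (Fin d) ℂ)
      (M : (y : Fin n) → Fin (D y) → Matrix (Fin d) (Fin d) ℂ),
    (∀ x, IsState (ρ x)) ∧
    (∀ y, IsPOVM (M y)) ∧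
    Compatible (ι := Fin n) (K := D) M ∧
    ∀ x y b, p x y b = born (ρ x) (M y b)}

end PrepMeas

end

noncomputable section

namespace PrepMeas

open Matrix Finset MeasureTheory

/-! The point is that a compatible strategy never beats the best deterministic one (Frenkel–Weiner).
Refine the parent POVM to rank-one effects, the columns of `V` with `V * Vᴴ = 1`. By Cauchy–Binet,
`|det V_t|² / d!` is a probability law on `d`-tuples `t` of outcomes, and it does not depend on the
state. For a set `A` of outcomes let `F` be the sum of the effects outside `A`. Then `det F` is the
probability that `t` avoids `A`, and `0 ≤ F ≤ 1` gives `F ≥ (det F) • 1`, so `A` has Born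
probability at most that of `t` meeting `A`. Integrating over superlevel sets
(`sum_mul_le_sum_mul_of_superlevel`), the mean score of a measured outcome is at most the mean of
the best score within `t`. Hence sharing `t` and sending the position of the best entry does at
least as well (`sum_born_mul_le_of_fintype`), and some deterministic strategy does at least as well
as that. Infinite parents follow by truncation. Deterministic strategies lie in all three sets:
diagonal matrices realise them quantumly. -/

/-! ### Cauchy–Binet and the law on tuples. -/

/-- Cauchy–Binet as a sum over all tuples of columns. -/
theorem det_mul_eq_sum_prod_det {d : ℕ} {I R : Type*} [Fintype I] [CommRing R]
    (A : Matrix (Fin d) I R) (B : Matrix I (Fin d) R) :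
    (A * B).det = ∑ t : Fin d → I, (∏ a, B (t a) a) * (A.submatrix id t).det := by
  simp only [det_apply', mul_apply, submatrix_apply, id]
  classical
  simp only [Finset.prod_univ_sum, Finset.mul_sum, Fintype.piFinset_univ]
  rw [Finset.sum_comm]
  refine Finset.sum_congr rfl fun t _ => Finset.sum_congr rfl fun σ _ => ?_
  rw [Finset.prod_mul_distrib]
  ring

/-- The Cauchy–Binet formula, symmetrised over the order of the columns. -/
theorem factorial_mul_det_mul {d : ℕ} {I R : Type*} [Fintype I] [CommRing R]
    (A : Matrix (Fin d) I R) (B : Matrix I (Fin d) R) :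
    (d.factorial : R) * (A * B).det =
      ∑ t : Fin d → I, (A.submatrix id t).det * (B.submatrix t id).det := by
  -- Substituting `t ∘ σ` for `t` permutes the columns of `A`, and the resulting sign cancels `sign
  -- σ`; so all `d!` permutations contribute equally.
  have key : ∀ σ : Equiv.Perm (Fin d),
      ∑ t : Fin d → I, (A.submatrix id t).det *
        (((Equiv.Perm.sign σ : ℤ) : R) * ∏ a, B (t (σ a)) a) = (A * B).det := by
    intro σ
    rw [det_mul_eq_sum_prod_det]
    refine Fintype.sum_equiv (σ.symm.arrowCongr (Equiv.refl I)) _ _ fun t => ?_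
    have h1 : (A.submatrix id t).submatrix id σ
        = A.submatrix id ((σ.symm.arrowCongr (Equiv.refl I)) t) := by
      ext i j; simp [Equiv.arrowCongr]
    have h2 := det_permute' σ (A.submatrix id t)
    rw [← h1, h2]
    simp only [Equiv.arrowCongr_apply, Equiv.coe_refl, Function.comp, id, Equiv.symm_symm]
    ring
  have h : ∀ t : Fin d → I, (B.submatrix t id).det
      = ∑ σ : Equiv.Perm (Fin d), ((Equiv.Perm.sign σ : ℤ) : R) * ∏ a, B (t (σ a)) a := by
    intro t; simp [det_apply']
  simp only [h, Finset.mul_sum]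
  rw [Finset.sum_comm, Finset.sum_congr rfl fun σ _ => key σ]
  simp [Fintype.card_perm]

/-- The mixed discriminant weight of a tuple of columns of `V`. -/
def tupleWeight {d : ℕ} {I : Type*} (V : Matrix (Fin d) I ℂ) (t : Fin d → I) : ℝ :=
  Complex.normSq (V.submatrix id t).det / d.factorial

theorem tupleWeight_nonneg {d : ℕ} {I : Type*} (V : Matrix (Fin d) I ℂ) (t : Fin d → I) :
    0 ≤ tupleWeight V t :=
  div_nonneg (Complex.normSq_nonneg _) (Nat.cast_nonneg _)

/-- With `w` the indicator of a set of outcomes, the right side is the probability that all entries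
of `t` lie in that set. -/
theorem det_mul_diagonal_mul_conjTranspose {d : ℕ} {I : Type*} [Fintype I] [DecidableEq I]
    (V : Matrix (Fin d) I ℂ) (w : I → ℝ) :
    (V * diagonal (fun i => (w i : ℂ)) * Vᴴ).det
      = ((∑ t : Fin d → I, tupleWeight V t * ∏ a, w (t a) : ℝ) : ℂ) := by
  have h := factorial_mul_det_mul V (diagonal (fun i => (w i : ℂ)) * Vᴴ)
  have hf : (d.factorial : ℂ) ≠ 0 := by exact_mod_cast d.factorial_ne_zero
  rw [Matrix.mul_assoc]
  apply mul_left_cancel₀ hf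
  rw [h]
  push_cast
  rw [Finset.mul_sum]
  refine Finset.sum_congr rfl fun t _ => ?_
  have : (diagonal (fun i => (w i : ℂ)) * Vᴴ).submatrix t id
      = of fun a b => (w (t a) : ℂ) * (V.submatrix id t)ᴴ a b := by
    ext a b; simp [diagonal_mul]
  rw [this, det_mul_column, det_conjTranspose, tupleWeight]
  push_cast
  rw [Complex.normSq_eq_conj_mul_self]
  field_simp
  simp [mul_comm]

theorem sum_tupleWeight {d : ℕ} {I : Type*} [Fintype I] {V : Matrix (Fin d) I ℂ}
    (hV : V * Vᴴ = 1) : ∑ t : Fin d → I, tupleWeight V t = 1 := by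
  classical
  have := det_mul_diagonal_mul_conjTranspose V (fun _ => (1 : ℝ))
  simp only [Complex.ofReal_one, diagonal_one, Matrix.mul_one, hV, det_one, prod_const_one,
    mul_one] at this
  exact_mod_cast this.symm

/-! ### The Born rule and the determinant bound. -/

theorem born_vecMulVec_nonneg {d : ℕ} {ρ : Matrix (Fin d) (Fin d) ℂ} (hρ : ρ.PosSemidef)
    (v : Fin d → ℂ) : 0 ≤ born ρ (vecMulVec v (star v)) := by
  rw [born, mul_vecMulVec, trace_vecMulVec, dotProduct_comm]
  exact hρ.re_dotProduct_nonneg v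

theorem born_sum {d : ℕ} {ι : Type*} (s : Finset ι) (ρ : Matrix (Fin d) (Fin d) ℂ)
    (E : ι → Matrix (Fin d) (Fin d) ℂ) : born ρ (∑ i ∈ s, E i) = ∑ i ∈ s, born ρ (E i) := by
  simp [born, Finset.mul_sum, trace_sum]

theorem born_sub {d : ℕ} (ρ E F : Matrix (Fin d) (Fin d) ℂ) :
    born ρ (E - F) = born ρ E - born ρ F := by
  simp [born, mul_sub]

theorem born_smul {d : ℕ} (ρ E : Matrix (Fin d) (Fin d) ℂ) (r : ℝ) :
    born ρ ((r : ℂ) • E) = r * born ρ E := by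
  simp [born]

theorem born_one {d : ℕ} {ρ : Matrix (Fin d) (Fin d) ℂ} (hρ : IsState ρ) : born ρ 1 = 1 := by
  simp [born, hρ.2]

theorem born_nonneg {d : ℕ} {ρ E : Matrix (Fin d) (Fin d) ℂ} (hρ : ρ.PosSemidef)
    (hE : E.PosSemidef) : 0 ≤ born ρ E := by
  obtain ⟨m, v, rfl⟩ := posSemidef_iff_eq_sum_vecMulVec.1 hE
  rw [born_sum]
  exact Finset.sum_nonneg fun i _ => born_vecMulVec_nonneg hρ _

/-- Diagonalising `A` also diagonalises `a • A + b • 1`. Used for `1 - F` and for `F - (det F) • 1`.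
-/
theorem posSemidef_smul_add_smul_one_iff {d : ℕ} {A : Matrix (Fin d) (Fin d) ℂ}
    (hA : A.IsHermitian) (a b : ℝ) :
    ((a : ℂ) • A + (b : ℂ) • (1 : Matrix (Fin d) (Fin d) ℂ)).PosSemidef ↔
      ∀ i, 0 ≤ a * hA.eigenvalues i + b := by
  have h : (a : ℂ) • A + (b : ℂ) • (1 : Matrix (Fin d) (Fin d) ℂ)
      = (hA.eigenvectorUnitary : Matrix (Fin d) (Fin d) ℂ) *
        diagonal (fun i => ((a * hA.eigenvalues i + b : ℝ) : ℂ)) *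
        star (hA.eigenvectorUnitary : Matrix (Fin d) (Fin d) ℂ) := by
    have h1 : diagonal (fun i => ((a * hA.eigenvalues i + b : ℝ) : ℂ))
        = (a : ℂ) • diagonal (fun i => (hA.eigenvalues i : ℂ))
          + (b : ℂ) • (1 : Matrix (Fin d) (Fin d) ℂ) := by
      ext i j
      by_cases hij : i = j
      · subst hij; simp
      · simp [hij]
    have h2 := hA.spectral_theorem
    rw [Unitary.conjStarAlgAut_apply] at h2
    rw [h1, mul_add, add_mul, mul_smul_comm, smul_mul_assoc, mul_smul_comm, smul_mul_assoc,
      mul_one, (Unitary.mem_iff.1 hA.eigenvectorUnitary.2).2]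
    conv_lhs => rw [h2]
    rfl
  rw [h, Unitary.isUnit_coe.posSemidef_star_right_conjugate_iff, posSemidef_diagonal_iff]
  simp only [Complex.zero_le_real]

/-- A matrix between `0` and `1` dominates its determinant. -/
theorem det_re_le_born {d : ℕ} {ρ F : Matrix (Fin d) (Fin d) ℂ} (hρ : IsState ρ)
    (hF : F.PosSemidef) (hF1 : (1 - F).PosSemidef) : F.det.re ≤ born ρ F := by
  have hle : ∀ i, hF.1.eigenvalues i ≤ 1 := by
    have := (posSemidef_smul_add_smul_one_iff hF.1 (-1) 1).1 (by
      convert hF1 using 1; push_cast; rw [neg_smul, one_smul, one_smul]; abel)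
    intro i
    linarith [this i]
  have hdet : F.det.re = ∏ i, hF.1.eigenvalues i := by
    rw [hF.1.det_eq_prod_eigenvalues]
    exact_mod_cast Complex.ofReal_re _
  -- The eigenvalues lie in `[0, 1]`, so their product is at most each of them.
  have hpsd := (posSemidef_smul_add_smul_one_iff hF.1 1 (-F.det.re)).2 (by
    intro i
    have : F.det.re ≤ hF.1.eigenvalues i := by
      rw [hdet, ← Finset.mul_prod_erase _ _ (mem_univ i)]
      exact mul_le_of_le_one_right (hF.eigenvalues_nonneg i)
        (Finset.prod_le_one (fun j _ => hF.eigenvalues_nonneg j) fun j _ => hle j)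
    linarith)
  have := born_nonneg hρ.1 hpsd
  have h2 : born ρ (((1 : ℝ) : ℂ) • F + ((-F.det.re : ℝ) : ℂ) • 1)
      = born ρ F - F.det.re := by
    have : ((1 : ℝ) : ℂ) • F + ((-F.det.re : ℝ) : ℂ) • (1 : Matrix (Fin d) (Fin d) ℂ)
        = F - ((F.det.re : ℝ) : ℂ) • 1 := by
      push_cast; rw [one_smul, neg_smul]; abel
    rw [this, born_sub, born_smul, born_one hρ, mul_one]
  linarith

/-! ### The Frenkel–Weiner inequality. -/

/-- If the superlevel sets of `w` have at most the mass of those of `u`, and the total masses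
agree, then the mean of `w` is at most that of `u`. -/
theorem sum_mul_le_sum_mul_of_superlevel {I T : Type*} [Fintype I] [Fintype T]
    (α w : I → ℝ) (μ u : T → ℝ) (htot : ∑ i, α i = ∑ t, μ t)
    (h : ∀ s : ℝ, (∑ i, α i * if s < w i then 1 else 0) ≤ ∑ t, μ t * if s < u t then 1 else 0) :
    ∑ i, α i * w i ≤ ∑ t, μ t * u t := by
  -- Layer cake on a bounded window: `r + C` is the integral over `s ∈ [-C, C]` of the indicator of
  -- `s < r`. The shift by `C` cancels because the total masses agree.
  obtain ⟨C, hCw, hCu⟩ : ∃ C : ℝ, (∀ i, |w i| ≤ C) ∧ ∀ t, |u t| ≤ C := by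
    refine ⟨(∑ i, |w i|) + ∑ t, |u t|, fun i => ?_, fun t => ?_⟩
    · have := Finset.single_le_sum (f := fun i => |w i|) (fun i _ => abs_nonneg _) (mem_univ i)
      have := Finset.sum_nonneg (s := univ) (f := fun t => |u t|) (fun i _ => abs_nonneg _)
      linarith
    · have := Finset.single_le_sum (f := fun i => |u i|) (fun i _ => abs_nonneg _) (mem_univ t)
      have := Finset.sum_nonneg (s := univ) (f := fun t => |w t|) (fun i _ => abs_nonneg _)
      linarith
  have hint : ∀ r : ℝ, IntervalIntegrable (fun s : ℝ => if s < r then (1 : ℝ) else 0)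
      MeasureTheory.volume (-C) C := fun r =>
    (antitone_iff_forall_lt.2 fun a b hab => by
      split_ifs <;> linarith).intervalIntegrable
  have hval : ∀ r : ℝ, |r| ≤ C → ∫ s in (-C)..C, (if s < r then (1 : ℝ) else 0) = r + C := by
    intro r hr
    obtain ⟨h1, h2⟩ := abs_le.1 hr
    rw [← intervalIntegral.integral_add_adjacent_intervals (b := r)
      ((hint r).mono_set (by
        rw [Set.uIcc_of_le h1, Set.uIcc_of_le (h1.trans h2)]; exact Set.Icc_subset_Icc_right h2))
      ((hint r).mono_set (by
        rw [Set.uIcc_of_le h2, Set.uIcc_of_le (h1.trans h2)]; exact Set.Icc_subset_Icc_left h1))]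
    have e1 : ∫ s in (-C)..r, (if s < r then (1 : ℝ) else 0) = ∫ s in (-C)..r, (1 : ℝ) := by
      rw [intervalIntegral.integral_of_le h1, intervalIntegral.integral_of_le h1,
        MeasureTheory.integral_Ioc_eq_integral_Ioo, MeasureTheory.integral_Ioc_eq_integral_Ioo]
      exact MeasureTheory.setIntegral_congr_fun measurableSet_Ioo fun s hs => if_pos hs.2
    have e2 : ∫ s in r..C, (if s < r then (1 : ℝ) else 0) = ∫ s in r..C, (0 : ℝ) :=
      intervalIntegral.integral_congr fun s hs => by
        rw [Set.uIcc_of_le h2] at hs; exact if_neg (not_lt.2 hs.1)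
    rw [e1, e2]; simp
  have hmono : ∫ s in (-C)..C, (∑ i, α i * if s < w i then 1 else 0)
      ≤ ∫ s in (-C)..C, ∑ t, μ t * if s < u t then 1 else 0 := by
    by_cases hC : 0 ≤ C
    · refine intervalIntegral.integral_mono (by linarith) ?_ ?_ h
      · simpa only [Finset.sum_fn] using
          IntervalIntegrable.sum univ fun i _ => (hint (w i)).const_mul (α i)
      · simpa only [Finset.sum_fn] using
          IntervalIntegrable.sum univ fun t _ => (hint (u t)).const_mul (μ t)
    · have : IsEmpty I := ⟨fun i => hC ((abs_nonneg _).trans (hCw i))⟩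
      have : IsEmpty T := ⟨fun i => hC ((abs_nonneg _).trans (hCu i))⟩
      simp
  rw [intervalIntegral.integral_finsetSum fun i _ => (hint _).const_mul _,
    intervalIntegral.integral_finsetSum fun i _ => (hint _).const_mul _] at hmono
  simp only [intervalIntegral.integral_const_mul] at hmono
  simp only [fun i => hval _ (hCw i), fun t => hval _ (hCu t)] at hmono
  simp only [mul_add, Finset.sum_add_distrib, ← Finset.sum_mul, htot] at hmono
  linarith

theorem mul_diagonal_mul_conjTranspose_eq_sum {d : ℕ} {I : Type*} [Fintype I] [DecidableEq I]
    (V : Matrix (Fin d) I ℂ) (w : I → ℝ) :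
    V * diagonal (fun i => (w i : ℂ)) * Vᴴ
      = ∑ i, (w i : ℂ) • vecMulVec (Vᵀ i) (star (Vᵀ i)) := by
  ext a b
  rw [mul_apply]
  simp only [mul_diagonal, Matrix.sum_apply, Matrix.smul_apply, vecMulVec_apply,
    conjTranspose_apply, transpose_apply, Pi.star_apply, smul_eq_mul]
  exact Finset.sum_congr rfl fun i _ => by ring

theorem posSemidef_mul_diagonal_mul_conjTranspose {d : ℕ} {I : Type*} [Fintype I] [DecidableEq I]
    (V : Matrix (Fin d) I ℂ) {w : I → ℝ} (hw : ∀ i, 0 ≤ w i) :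
    (V * diagonal (fun i => (w i : ℂ)) * Vᴴ).PosSemidef :=
  (PosSemidef.diagonal fun i => by simpa using hw i).mul_mul_conjTranspose_same V

/-- The Frenkel–Weiner inequality for a rank-one parent measurement. -/
theorem sum_born_mul_le_sum_tupleWeight_mul {d : ℕ} {I : Type*} [Fintype I]
    {V : Matrix (Fin d) I ℂ} (hV : V * Vᴴ = 1) {ρ : Matrix (Fin d) (Fin d) ℂ} (hρ : IsState ρ)
    (w : I → ℝ) (u : (Fin d → I) → ℝ) (hu : ∀ t m, w (t m) ≤ u t) :
    ∑ i, born ρ (vecMulVec (Vᵀ i) (star (Vᵀ i))) * w i ≤ ∑ t, tupleWeight V t * u t := by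
  classical
  have hborn : ∀ χ : I → ℝ, born ρ (V * diagonal (fun i => (χ i : ℂ)) * Vᴴ)
      = ∑ i, born ρ (vecMulVec (Vᵀ i) (star (Vᵀ i))) * χ i := by
    intro χ
    rw [mul_diagonal_mul_conjTranspose_eq_sum, born_sum]
    exact Finset.sum_congr rfl fun i _ => by rw [born_smul, mul_comm]
  have hone : V * diagonal (fun _ : I => ((1 : ℝ) : ℂ)) * Vᴴ = (1 : Matrix (Fin d) (Fin d) ℂ) := by
    simpa using hV
  have hμ := sum_tupleWeight hV
  have hα : ∑ i, born ρ (vecMulVec (Vᵀ i) (star (Vᵀ i))) = 1 := by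
    have := hborn (fun _ => 1)
    rw [hone, born_one hρ] at this
    simpa using this.symm
  refine sum_mul_le_sum_mul_of_superlevel _ _ _ _ (hα.trans hμ.symm) fun s => ?_
  set χ : I → ℝ := fun i => if s < w i then 1 else 0 with hχ
  have hχ0 : ∀ i, 0 ≤ χ i := fun i => by simp only [hχ]; split_ifs <;> norm_num
  have hχ1 : ∀ i, 0 ≤ 1 - χ i := fun i => by simp only [hχ]; split_ifs <;> norm_num
  -- `F` collects the effects with `w i ≤ s`; its determinant is the probability that no entry of
  -- `t` exceeds level `s`.
  have hF := posSemidef_mul_diagonal_mul_conjTranspose V hχ1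
  have hF1 : (1 - V * diagonal (fun i => ((1 - χ i : ℝ) : ℂ)) * Vᴴ).PosSemidef := by
    convert posSemidef_mul_diagonal_mul_conjTranspose V hχ0 using 1
    conv_lhs => rw [← hone]
    rw [← Matrix.sub_mul, ← Matrix.mul_sub, diagonal_sub]
    simp
  have key := det_re_le_born hρ hF hF1
  rw [det_mul_diagonal_mul_conjTranspose, Complex.ofReal_re, hborn] at key
  simp only [mul_sub, mul_one, Finset.sum_sub_distrib, hα] at key
  have hstep : ∑ t : Fin d → I, tupleWeight V t * (1 - if s < u t then 1 else 0)
      ≤ ∑ t : Fin d → I, tupleWeight V t * ∏ a, (1 - χ (t a)) := by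
    refine Finset.sum_le_sum fun t _ => mul_le_mul_of_nonneg_left ?_ (tupleWeight_nonneg V t)
    by_cases h : s < u t
    · simpa [h] using Finset.prod_nonneg fun a _ => hχ1 (t a)
    · have : ∀ a, χ (t a) = 0 := fun a => if_neg fun h' => h (h'.trans_le (hu t a))
      simp [h, this]
  simp only [mul_sub, mul_one, Finset.sum_sub_distrib, hμ] at hstep
  linarith

/-- A finite parent measurement on `ℂ^d` is no better than a classical message in `[d]`. -/
theorem sum_born_mul_le_of_fintype {d l : ℕ} (hd : 0 < d) {κ : Type*} [Fintype κ]
    {G : κ → Matrix (Fin d) (Fin d) ℂ} (hG : ∀ k, (G k).PosSemidef) (hG1 : ∑ k, G k = 1)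
    {ρ : Fin l → Matrix (Fin d) (Fin d) ℂ} (hρ : ∀ x, IsState (ρ x)) (W : Fin l → κ → ℝ) (v : ℝ)
    (hv : ∀ (f : Fin l → Fin d) (t : Fin d → κ), ∑ x, W x (t (f x)) ≤ v) :
    ∑ x, ∑ k, born (ρ x) (G k) * W x k ≤ v := by
  have : Nonempty (Fin d) := ⟨⟨0, hd⟩⟩
  choose m e he using fun k => posSemidef_iff_eq_sum_vecMulVec.1 (hG k)
  let V : Matrix (Fin d) (Σ k, Fin (m k)) ℂ := of fun a i => e i.1 i.2 a
  have hcol : ∀ i, Vᵀ i = e i.1 i.2 := fun i => rfl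
  have hV : V * Vᴴ = 1 := by
    classical
    have := mul_diagonal_mul_conjTranspose_eq_sum V (fun _ => 1)
    simp only [Complex.ofReal_one, diagonal_one, Matrix.mul_one, one_smul, hcol] at this
    rw [this, ← hG1, Fintype.sum_sigma]
    exact Finset.sum_congr rfl fun k _ => (he k).symm
  -- Given the shared tuple `t`, `f t x` is Alice's best message on input `x`.
  choose f hf using fun (t : Fin d → Σ k, Fin (m k)) (x : Fin l) =>
    Finite.exists_max fun a => W x (t a).1
  have hx : ∀ x, ∑ k, born (ρ x) (G k) * W x k
      ≤ ∑ t, tupleWeight V t * W x (t (f t x)).1 := by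
    intro x
    have := sum_born_mul_le_sum_tupleWeight_mul hV (hρ x) (fun i => W x i.1)
      (fun t => W x (t (f t x)).1) (fun t a => hf t x a)
    refine le_trans (le_of_eq ?_) this
    rw [Fintype.sum_sigma]
    refine Finset.sum_congr rfl fun k _ => ?_
    simp only [hcol]
    rw [← Finset.sum_mul, ← born_sum, ← he k]
  have hμ := sum_tupleWeight hV
  calc ∑ x, ∑ k, born (ρ x) (G k) * W x k
      ≤ ∑ x, ∑ t, tupleWeight V t * W x (t (f t x)).1 := Finset.sum_le_sum fun x _ => hx x
    _ = ∑ t, tupleWeight V t * ∑ x, W x (t (f t x)).1 := by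
        rw [Finset.sum_comm]; simp only [Finset.mul_sum]
    _ ≤ ∑ t, tupleWeight V t * v := Finset.sum_le_sum fun t _ =>
        mul_le_mul_of_nonneg_left (hv (f t) fun a => (t a).1) (tupleWeight_nonneg V t)
    _ = v := by rw [← Finset.sum_mul, hμ, one_mul]

/-! ### Parents with infinitely many outcomes. -/

theorem IsPOVM.posSemidef_one_sub_sum {d : ℕ} {κ : Type} {G : κ → Matrix (Fin d) (Fin d) ℂ}
    (hG : IsPOVM G) (F : Finset κ) : (1 - ∑ k ∈ F, G k).PosSemidef := by
  refine PosSemidef.of_dotProduct_mulVec_nonneg ?_ fun x => ?_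
  · exact isHermitian_one.sub (posSemidef_sum F fun k _ => hG.1 k).1
  · have hs : HasSum (fun k => star x ⬝ᵥ (G k *ᵥ x)) (star x ⬝ᵥ ((1 : Matrix _ _ ℂ) *ᵥ x)) := by
      let φ : Matrix (Fin d) (Fin d) ℂ →+ ℂ :=
        { toFun := fun A => star x ⬝ᵥ (A *ᵥ x)
          map_zero' := by simp
          map_add' := fun A B => by simp [add_mulVec] }
      refine hG.2.map φ ?_
      change Continuous fun A : Matrix (Fin d) (Fin d) ℂ => star x ⬝ᵥ (A *ᵥ x)
      fun_prop
    have h := sum_le_hasSum F (fun k _ => (hG.1 k).dotProduct_mulVec_nonneg x) hs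
    rw [sub_mulVec, dotProduct_sub, sum_mulVec, dotProduct_sum]
    exact sub_nonneg.2 h

theorem continuous_born {d : ℕ} (ρ : Matrix (Fin d) (Fin d) ℂ) : Continuous (born ρ) := by
  unfold born
  fun_prop

theorem hasSum_born {d : ℕ} {κ : Type*} (ρ : Matrix (Fin d) (Fin d) ℂ)
    {E : κ → Matrix (Fin d) (Fin d) ℂ} {A : Matrix (Fin d) (Fin d) ℂ} (h : HasSum E A) :
    HasSum (fun k => born ρ (E k)) (born ρ A) := by
  let φ : Matrix (Fin d) (Fin d) ℂ →+ ℝ :=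
    { toFun := born ρ
      map_zero' := by simp [born]
      map_add' := fun A B => by simp [born, mul_add] }
  exact h.map φ (continuous_born ρ)

/-- A discrete parent measurement on `ℂ^d` is no better than a classical message in `[d]`. -/
theorem IsPOVM.sum_hasSum_born_mul_le {d l : ℕ} (hd : 0 < d) {κ : Type}
    {G : κ → Matrix (Fin d) (Fin d) ℂ} (hG : IsPOVM G)
    {ρ : Fin l → Matrix (Fin d) (Fin d) ℂ} (hρ : ∀ x, IsState (ρ x)) (W : Fin l → κ → ℝ) (v : ℝ)
    (hv : ∀ (f : Fin l → Fin d) (t : Fin d → κ), ∑ x, W x (t (f x)) ≤ v)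
    (B : Fin l → ℝ) (hB : ∀ x, HasSum (fun k => born (ρ x) (G k) * W x k) (B x)) :
    ∑ x, B x ≤ v := by
  have : Nonempty (Fin d) := ⟨⟨0, hd⟩⟩
  obtain ⟨k0⟩ : Nonempty κ := by
    by_contra hκ
    rw [not_nonempty_iff] at hκ
    exact one_ne_zero (hG.2.unique hasSum_empty)
  have hfin : ∀ F : Finset κ, ∑ x, (∑ k ∈ F, born (ρ x) (G k) * W x k
      + born (ρ x) (1 - ∑ k ∈ F, G k) * W x k0) ≤ v := by
    intro F
    -- The missing effect `1 - ∑ k ∈ F, G k` is an extra outcome, scored as `k0`; its weight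
    -- vanishes in the limit.
    let G' : Option F → Matrix (Fin d) (Fin d) ℂ := fun o => o.elim (1 - ∑ k ∈ F, G k) fun k => G k
    let r : Option F → κ := fun o => o.elim k0 fun k => k
    have h := sum_born_mul_le_of_fintype hd (G := G') (fun o => by
        cases o with
        | none => exact hG.posSemidef_one_sub_sum F
        | some k => exact hG.1 k) (by
        rw [Fintype.sum_option]
        simp only [G', Option.elim]
        rw [Finset.sum_coe_sort F G]; abel) hρ (fun x o => W x (r o)) v
        (fun f t => hv f fun m => r (t m))
    refine le_trans (le_of_eq (Finset.sum_congr rfl fun x _ => ?_)) h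
    rw [Fintype.sum_option]
    simp only [G', r, Option.elim]
    rw [Finset.sum_coe_sort F fun k => born (ρ x) (G k) * W x k, add_comm]
  have hlim : Filter.Tendsto (fun F : Finset κ => ∑ x, (∑ k ∈ F, born (ρ x) (G k) * W x k
      + born (ρ x) (1 - ∑ k ∈ F, G k) * W x k0)) Filter.atTop
      (nhds (∑ x, (B x + born (ρ x) (1 - 1) * W x k0))) := by
    refine tendsto_finsetSum _ fun x _ =>
      Filter.Tendsto.add (hB x) (Filter.Tendsto.mul_const _ ?_)
    exact ((continuous_born (ρ x)).tendsto _).comp (tendsto_const_nhds.sub hG.2)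
  have := le_of_tendsto' hlim hfin
  simpa [born] using this

/-! ### Linear functionals and the deterministic optimum. -/

theorem map_pi_eq_sum {ι : Type*} [Fintype ι] [DecidableEq ι] {φ : ι → Type*}
    [∀ i, AddCommMonoid (φ i)] [∀ i, Module ℝ (φ i)] (T : ((i : ι) → φ i) →ₗ[ℝ] ℝ)
    (p : (i : ι) → φ i) : T p = ∑ i, (T ∘ₗ LinearMap.single ℝ φ i) (p i) := by
  conv_lhs => rw [← Finset.univ_sum_single p, map_sum]
  rfl

theorem map_stat_eq_sum {l n : ℕ} {D : Fin n → ℕ} (S : Stat l n D →ₗ[ℝ] ℝ) :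
    ∃ c : Stat l n D, ∀ p, S p = ∑ x, ∑ y, ∑ b, c x y b * p x y b := by
  refine ⟨fun x y b => (((S ∘ₗ LinearMap.single ℝ _ x) ∘ₗ LinearMap.single ℝ _ y) ∘ₗ
    LinearMap.single ℝ _ b) 1, fun p => ?_⟩
  rw [map_pi_eq_sum]
  refine Finset.sum_congr rfl fun x _ => ?_
  rw [map_pi_eq_sum]
  refine Finset.sum_congr rfl fun y _ => ?_
  rw [map_pi_eq_sum]
  refine Finset.sum_congr rfl fun b _ => ?_
  rw [mul_comm, ← smul_eq_mul, ← map_smul, smul_eq_mul, mul_one]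

theorem IsDistr.sum_mul_le {α : Type} [Fintype α] {q : α → ℝ} (hq : IsDistr q) {u : α → ℝ} {v : ℝ}
    (hu : ∀ a, u a ≤ v) : ∑ a, q a * u a ≤ v :=
  calc ∑ a, q a * u a ≤ ∑ a, q a * v :=
        Finset.sum_le_sum fun a _ => mul_le_mul_of_nonneg_left (hu a) (hq.1 a)
    _ = v := by rw [← Finset.sum_mul, hq.2, one_mul]

theorem IsDistr.le_one {α : Type} [Fintype α] {q : α → ℝ} (hq : IsDistr q) (a : α) : q a ≤ 1 :=
  hq.2 ▸ Finset.single_le_sum (fun a _ => hq.1 a) (mem_univ a)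

theorem isDistr_ite {α : Type} [Fintype α] [DecidableEq α] (a : α) :
    IsDistr fun b => if a = b then (1 : ℝ) else 0 :=
  ⟨fun b => by dsimp only; split_ifs <;> norm_num, by simp⟩

/-- The best deterministic strategy is optimal among those with a stochastic decoding. -/
theorem exists_optimal_deterministic {d l n : ℕ} {D : Fin n → ℕ} (hd : 0 < d)
    (hD : ∀ y, 0 < D y) (c : Stat l n D) :
    ∃ (f : Fin l → Fin d) (g : (y : Fin n) → Fin d → Fin (D y)),
      ∀ q : (y : Fin n) → Fin d → Fin (D y) → ℝ, (∀ y m, IsDistr (q y m)) →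
        ∀ f' : Fin l → Fin d, ∑ x, ∑ y, ∑ b, c x y b * q y (f' x) b ≤
          ∑ x, ∑ y, c x y (g y (f x)) := by
  have : Nonempty (Fin d) := ⟨⟨0, hd⟩⟩
  have : ∀ y, Nonempty (Fin (D y)) := fun y => ⟨⟨0, hD y⟩⟩
  obtain ⟨⟨f, g⟩, hfg⟩ := Finite.exists_max
    fun s : (Fin l → Fin d) × ((y : Fin n) → Fin d → Fin (D y)) =>
      ∑ x, ∑ y, c x y (s.2 y (s.1 x))
  refine ⟨f, g, fun q hq f' => ?_⟩
  -- For a fixed encoding the score is linear in each `q y m`, so a single best output for each `(y,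
  -- m)` suffices.
  choose g' hg' using fun (y : Fin n) (m : Fin d) =>
    Finite.exists_max fun b : Fin (D y) => ∑ x with f' x = m, c x y b
  refine le_trans ?_ (hfg (f', g'))
  rw [Finset.sum_comm, Finset.sum_comm (f := fun x y => c x y (g' y (f' x)))]
  refine Finset.sum_le_sum fun y _ => ?_
  rw [← Finset.sum_fiberwise univ f', ← Finset.sum_fiberwise univ f']
  refine Finset.sum_le_sum fun m _ => ?_
  calc ∑ x with f' x = m, ∑ b, c x y b * q y (f' x) b
      = ∑ b, q y m b * ∑ x with f' x = m, c x y b := by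
        rw [Finset.sum_comm]
        refine Finset.sum_congr rfl fun b _ => ?_
        rw [Finset.mul_sum]
        refine Finset.sum_congr rfl fun x hx => ?_
        rw [(Finset.mem_filter.1 hx).2, mul_comm]
    _ ≤ ∑ x with f' x = m, c x y (g' y m) := (hq y m).sum_mul_le (hg' y m)
    _ = ∑ x with f' x = m, c x y (g' y (f' x)) :=
        Finset.sum_congr rfl fun x hx => by rw [(Finset.mem_filter.1 hx).2]

theorem sum_mul_integral_le {l n : ℕ} {D : Fin n → ℕ} (c : Stat l n D) {Ω : Type}
    [MeasurableSpace Ω] {μ : Measure Ω} [IsProbabilityMeasure μ]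
    {h : (x : Fin l) → (y : Fin n) → Fin (D y) → Ω → ℝ}
    (hint : ∀ x y b, Integrable (h x y b) μ) {v : ℝ}
    (hv : ∀ ω, ∑ x, ∑ y, ∑ b, c x y b * h x y b ω ≤ v) :
    ∑ x, ∑ y, ∑ b, c x y b * ∫ ω, h x y b ω ∂μ ≤ v := by
  have h1 : ∀ x y b, Integrable (fun ω => c x y b * h x y b ω) μ :=
    fun x y b => (hint x y b).const_mul _
  have h2 : ∀ x y, Integrable (fun ω => ∑ b, c x y b * h x y b ω) μ :=
    fun x y => integrable_finsetSum _ fun b _ => h1 x y b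
  have h3 : ∀ x, Integrable (fun ω => ∑ y, ∑ b, c x y b * h x y b ω) μ :=
    fun x => integrable_finsetSum _ fun y _ => h2 x y
  calc ∑ x, ∑ y, ∑ b, c x y b * ∫ ω, h x y b ω ∂μ
      = ∫ ω, ∑ x, ∑ y, ∑ b, c x y b * h x y b ω ∂μ := by
        rw [integral_finsetSum _ fun x _ => h3 x]
        refine Finset.sum_congr rfl fun x _ => ?_
        rw [integral_finsetSum _ fun y _ => h2 x y]
        refine Finset.sum_congr rfl fun y _ => ?_
        rw [integral_finsetSum _ fun b _ => h1 x y b]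
        simp only [integral_const_mul]
    _ ≤ ∫ _, v ∂μ :=
        integral_mono (integrable_finsetSum _ fun x _ => h3 x) (integrable_const v) hv
    _ = v := by simp

theorem integrable_of_mem_unitInterval {Ω : Type} [MeasurableSpace Ω] {μ : Measure Ω}
    [IsProbabilityMeasure μ] {h : Ω → ℝ} (hm : Measurable h) (h0 : ∀ ω, 0 ≤ h ω)
    (h1 : ∀ ω, h ω ≤ 1) : Integrable h μ :=
  Integrable.of_bound hm.aestronglyMeasurable 1 (Filter.Eventually.of_forall fun ω => by
    rw [Real.norm_of_nonneg (h0 ω)]; exact h1 ω)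

/-! ### Upper bounds, pointwise in the shared randomness. -/

variable {d l n : ℕ} {D : Fin n → ℕ} {c : Stat l n D} {v : ℝ}

theorem le_of_mem_classicalSet (hd : 0 < d)
    (hv : ∀ q : (y : Fin n) → Fin d → Fin (D y) → ℝ, (∀ y m, IsDistr (q y m)) →
        ∀ f : Fin l → Fin d, ∑ x, ∑ y, ∑ b, c x y b * q y (f x) b ≤ v)
    {p : Stat l n D} (hp : p ∈ classicalSet d l n D) :
    ∑ x, ∑ y, ∑ b, c x y b * p x y b ≤ v := by
  obtain ⟨Ω, _, μ, pa, pb, _, ha, hb, hma, hmb, hp⟩ := hp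
  have : Nonempty (Fin d) := ⟨⟨0, hd⟩⟩
  have hint : ∀ x y b m, Integrable (fun ω => pa x ω m * pb y m ω b) μ := fun x y b m =>
    integrable_of_mem_unitInterval ((hma x m).mul (hmb y m b))
      (fun ω => mul_nonneg ((ha x ω).1 m) ((hb y m ω).1 b))
      (fun ω => mul_le_one₀ ((ha x ω).le_one m) ((hb y m ω).1 b) ((hb y m ω).le_one b))
  simp only [hp, ← integral_finsetSum _ fun m _ => hint _ _ _ m]
  refine sum_mul_integral_le c (fun x y b => integrable_finsetSum _ fun m _ => hint x y b m)
    fun ω => ?_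
  -- For fixed `ω` the score is linear in `pa x ω`, so Alice may send one best message.
  choose f hf using fun x => Finite.exists_max fun m => ∑ y, ∑ b, c x y b * pb y m ω b
  refine le_trans (Finset.sum_le_sum fun x _ => ?_)
    (hv (fun y m => pb y m ω) (fun y m => hb y m ω) f)
  refine le_trans (le_of_eq ?_) ((ha x ω).sum_mul_le (hf x))
  simp only [Finset.mul_sum]
  rw [Finset.sum_comm (s := univ (α := Fin d))]
  refine Finset.sum_congr rfl fun y _ => ?_
  rw [Finset.sum_comm (s := univ (α := Fin d))]
  exact Finset.sum_congr rfl fun b _ => Finset.sum_congr rfl fun m _ => by ring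

theorem IsPOVM.born_le_one {κ : Type} {G : κ → Matrix (Fin d) (Fin d) ℂ} (hG : IsPOVM G)
    {ρ : Matrix (Fin d) (Fin d) ℂ} (hρ : IsState ρ) (k : κ) : born ρ (G k) ≤ 1 := by
  have h := born_nonneg hρ.1 (hG.posSemidef_one_sub_sum {k})
  rw [Finset.sum_singleton, born_sub, born_one hρ] at h
  linarith

theorem le_of_mem_quantumCompatSet (hd : 0 < d)
    (hv : ∀ q : (y : Fin n) → Fin d → Fin (D y) → ℝ, (∀ y m, IsDistr (q y m)) →
        ∀ f : Fin l → Fin d, ∑ x, ∑ y, ∑ b, c x y b * q y (f x) b ≤ v)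
    {p : Stat l n D} (hp : p ∈ quantumCompatSet d l n D) :
    ∑ x, ∑ y, ∑ b, c x y b * p x y b ≤ v := by
  obtain ⟨Ω, _, μ, ρ, M, _, hρ, hM, hmρ, hmM, ⟨κ, G, P, hG, hP, hPM⟩, hp⟩ := hp
  simp only [hp]
  refine sum_mul_integral_le c (fun x y b => integrable_of_mem_unitInterval ?_
    (fun ω => born_nonneg (hρ x ω).1 ((hM y ω).1 b)) fun ω => (hM y ω).born_le_one (hρ x ω) b)
    fun ω => ?_
  · simp only [born, trace, Matrix.diag, mul_apply]
    exact Complex.measurable_re.comp <| Finset.measurable_fun_sum _ fun i _ =>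
      Finset.measurable_fun_sum _ fun j _ => (hmρ x i j).mul (hmM y b j i)
  -- For fixed `ω`, a tuple `t` of parent outcomes turns the post-processing into a classical
  -- decoding: on message `m`, Bob acts as if the parent had output `t m`.
  refine hG.sum_hasSum_born_mul_le hd (fun x => hρ x ω)
    (fun x k => ∑ y, ∑ b, c x y b * P (y, ω) b k) v
    (fun f t => hv (fun y m b => P (y, ω) b (t m)) (fun y m => hP (y, ω) (t m)) f) _ fun x => ?_
  simp only [Finset.mul_sum]
  refine hasSum_sum fun y _ => hasSum_sum fun b _ => ?_
  have h := (hasSum_born (ρ x ω) (hPM (y, ω) b)).mul_left (c x y b)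
  simp only [born_smul] at h
  have e : (fun k => born (ρ x ω) (G k) * (c x y b * P (y, ω) b k))
      = fun k => c x y b * (P (y, ω) b k * born (ρ x ω) (G k)) := by
    ext k; ring
  rw [e]
  exact h

/-! ### Attainment by deterministic strategies. -/

/-- The statistics of the deterministic strategy `(f, g)`. -/
def deterministicStat (f : Fin l → Fin d) (g : (y : Fin n) → Fin d → Fin (D y)) : Stat l n D :=
  fun x y b => if g y (f x) = b then 1 else 0

theorem deterministicStat_mem_classicalSet (f : Fin l → Fin d)
    (g : (y : Fin n) → Fin d → Fin (D y)) :
    deterministicStat f g ∈ classicalSet d l n D := by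
  refine ⟨Unit, inferInstance, Measure.dirac (), fun x _ m => if f x = m then 1 else 0,
    fun y m _ b => if g y m = b then 1 else 0, inferInstance, fun x _ => isDistr_ite _,
    fun y m _ => isDistr_ite _, fun _ _ => measurable_const, fun _ _ _ => measurable_const,
    fun x y b => ?_⟩
  simp only [integral_dirac, deterministicStat, ite_mul, one_mul, zero_mul]
  simp

theorem quantumCompatSetNoSR_subset :
    quantumCompatSetNoSR d l n D ⊆ quantumCompatSet d l n D := by
  rintro p ⟨ρ, M, hρ, hM, ⟨κ, G, P, hG, hP, hPM⟩, hp⟩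
  refine ⟨Unit, inferInstance, Measure.dirac (), fun x _ => ρ x, fun y _ => M y, inferInstance,
    fun x _ => hρ x, fun y _ => hM y, fun _ _ _ => measurable_const,
    fun _ _ _ _ => measurable_const,
    ⟨κ, G, fun i => P i.1, hG, fun i => hP i.1, fun i => hPM i.1⟩, fun x y b => ?_⟩
  simp [hp]

theorem posSemidef_diagonal_ite (s : Fin d → Prop) [DecidablePred s] :
    (diagonal fun i => if s i then (1 : ℂ) else 0).PosSemidef :=
  PosSemidef.diagonal fun i => by
    change (0 : ℂ) ≤ if s i then 1 else 0
    split_ifs <;> simp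

theorem isPOVM_diagonal_ite {k : ℕ} (g : Fin d → Fin k) :
    IsPOVM fun b : Fin k => diagonal fun i => if g i = b then (1 : ℂ) else 0 := by
  refine ⟨fun b => posSemidef_diagonal_ite _, ?_⟩
  have h : (1 : Matrix (Fin d) (Fin d) ℂ)
      = ∑ b : Fin k, diagonal fun i => if g i = b then (1 : ℂ) else 0 := by
    ext i j
    by_cases hij : i = j
    · subst hij; simp [Matrix.sum_apply]
    · simp [Matrix.sum_apply, hij]
  rw [h]
  exact hasSum_fintype _

theorem deterministicStat_mem_quantumCompatSetNoSR (f : Fin l → Fin d)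
    (g : (y : Fin n) → Fin d → Fin (D y)) :
    deterministicStat f g ∈ quantumCompatSetNoSR d l n D := by
  -- Alice sends the basis state `f x`; the parent is the computational-basis measurement,
  -- post-processed by `g y`.
  refine ⟨fun x => diagonal fun i => if f x = i then 1 else 0,
    fun y b => diagonal fun i => if g y i = b then 1 else 0,
    fun x => ⟨posSemidef_diagonal_ite _, by simp [trace_diagonal]⟩, fun y => isPOVM_diagonal_ite _,
    ⟨Fin d, fun k => diagonal fun i => if i = k then 1 else 0,
      fun y b k => if g y k = b then 1 else 0, isPOVM_diagonal_ite id,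
      fun y k => isDistr_ite _, fun y b => ?_⟩, fun x y b => ?_⟩
  · have h : (diagonal fun i => if g y i = b then (1 : ℂ) else 0)
        = ∑ k : Fin d, ((if g y k = b then 1 else 0 : ℝ) : ℂ) •
          diagonal fun i => if i = k then (1 : ℂ) else 0 := by
      ext i j
      by_cases hij : i = j
      · subst hij
        simp only [Matrix.sum_apply, Matrix.smul_apply, diagonal_apply_eq, smul_eq_mul,
          mul_ite, mul_one, mul_zero, Finset.sum_ite_eq, mem_univ, if_true]
        split_ifs <;> simp
      · simp only [Matrix.sum_apply, Matrix.smul_apply, diagonal_apply_ne _ hij, smul_zero,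
          Finset.sum_const_zero]
    beta_reduce
    rw [h]
    exact hasSum_fintype _
  · simp only [born, diagonal_mul_diagonal, trace_diagonal, deterministicStat, ite_mul, one_mul,
      zero_mul, Finset.sum_ite_eq, mem_univ, if_true]
    split_ifs <;> simp

end PrepMeas

end

theorem fact1 (d l n : ℕ) (D : Fin n → ℕ) (hd : 0 < d) (hD : ∀ y, 0 < D y)
    (S : PrepMeas.Stat l n D →ₗ[ℝ] ℝ) :
    ∃ v : ℝ,
      IsGreatest (S '' PrepMeas.classicalSet d l n D) v ∧
      IsGreatest (S '' PrepMeas.quantumCompatSet d l n D) v ∧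
      IsGreatest (S '' PrepMeas.quantumCompatSetNoSR d l n D) v := by
  obtain ⟨c, hc⟩ := PrepMeas.map_stat_eq_sum S
  obtain ⟨f, g, hv⟩ := PrepMeas.exists_optimal_deterministic hd hD c
  have hS : S (PrepMeas.deterministicStat f g) = ∑ x, ∑ y, c x y (g y (f x)) := by
    simp [hc, PrepMeas.deterministicStat]
  have hQ := PrepMeas.deterministicStat_mem_quantumCompatSetNoSR f g
  refine ⟨_, ⟨⟨_, PrepMeas.deterministicStat_mem_classicalSet f g, hS⟩, ?_⟩,
    ⟨⟨_, PrepMeas.quantumCompatSetNoSR_subset hQ, hS⟩, ?_⟩, ⟨_, hQ, hS⟩, ?_⟩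
  · rintro _ ⟨p, hp, rfl⟩
    rw [hc]; exact PrepMeas.le_of_mem_classicalSet hd hv hp
  · rintro _ ⟨p, hp, rfl⟩
    rw [hc]; exact PrepMeas.le_of_mem_quantumCompatSet hd hv hp
  · rintro _ ⟨p, hp, rfl⟩
    rw [hc]
    exact PrepMeas.le_of_mem_quantumCompatSet hd hv (PrepMeas.quantumCompatSetNoSR_subset hp)
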